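/- Let $s\in(0,1)$, $n\ge 2$, let $\Omega\subset\mathbb R^n$ be a bounded open set, and let $0<\lambda\le\Lambda<\infty$. For $\psi\in C_c^\infty(\mathbb R^n)$ let \[ \nabla^s\psi(x)=\frac{n-1+s}{\gamma_{1-s}}\int_{\mathbb R^n}\frac{(\psi(x)-\psi(y))(x-y)}{|x-y|^{n+s+1}}\,dy,\qquad \gamma_\alpha=2^\alpha\pi^{n/2}\frac{\Gamma(\alpha/2)}{\Gamma((n-\alpha)/2)}, \] let $H^s_0(\Omega)$ be the closure of $C_c^\infty(\Omega)$ with respect to the norm $\big(\|\psi\|_{L^2(\mathbb R^n)}^2+\|\nabla^s\psi\|_{L^2(\mathbb R^n;\mathbb R^n)}^2\big)^{1/2}$ (to which $\nabla^s$ extends by continuity), and let $H^{-s}(\Omega)$ be its dual. Let $\mathcal M(\lambda,\Lambda,\mathbb R^n)$ be the set of measurable $A\colon\mathbb R^n\to\mathbb R^{n\times n}$ such that, for a.e. $x\in\mathbb R^n$ and all $\xi\in\mathbb R^n$, $A(x)\xi\cdot\xi\ge\lambda|\xi|^2$ and $A(x)\xi\cdot\xi\ge\Lambda^{-1}|A(x)\xi|^2$.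 For $A_0\in\mathcal M(\lambda,\Lambda,\mathbb R^n)$ let $\mathcal M(\lambda,\Lambda,\Omega,A_0)$ be the set of $A\in\mathcal M(\lambda,\Lambda,\mathbb R^n)$ with $A=A_0$ a.e. in $\mathbb R^n\setminus\Omega$. For $A\in\mathcal M(\lambda,\Lambda,\mathbb R^n)$ and $f\in H^{-s}(\Omega)$, the weak solution of $-\mathrm{div}^s(A\nabla^su)=f$ in $\Omega$, $u=0$ in $\mathbb R^n\setminus\Omega$, is the unique $u\in H^s_0(\Omega)$ with $\int_{\mathbb R^n}A\nabla^su\cdot\nabla^sv\,dx=\langle f,v\rangle$ for all $v\in H^s_0(\Omega)$. A sequence $(A_h)_h\subset\mathcal M(\lambda,\Lambda,\mathbb R^n)$ $H$-converges to $A_\infty\in\mathcal M(\lambda,\Lambda,\mathbb R^n)$ in $H^s_0(\Omega)$ if for every $f\in H^{-s}(\Omega)$ the weak solutions $u_h$, $u_\infty$ corresponding to $A_h$, $A_\infty$ satisfy, as $h\to\infty$, $u_h\to u_\infty$ weakly in $H^s_0(\Omega)$ and $A_h\nabla^su_h\to A_\infty\nabla^su_\infty$ weakly in $L^2(\mathbb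 R^n;\mathbb R^n)$. Let $A_0\in\mathcal M(\lambda,\Lambda,\mathbb R^n)$, let $(A_h)_h\subset\mathcal M(\lambda,\Lambda,\Omega,A_0)$ and let $A_\infty,\widehat A_\infty\in\mathcal M(\lambda,\Lambda,\Omega,A_0)$. If $(A_h)_h$ $H$-converges in $H^s_0(\Omega)$ both to $A_\infty$ and to $\widehat A_\infty$, then $A_\infty(x)=\widehat A_\infty(x)$ for a.e. $x\in\mathbb R^n$. -/

import Mathlib

open MeasureTheory Filter Topology
open scoped ContDiff Matrix

namespace FracH

/-- The Euclidean space `ℝⁿ`. -/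
abbrev Eu (n : ℕ) := EuclideanSpace ℝ (Fin n)

/-- The action of a square matrix on a vector of `ℝⁿ`. -/
def act {n : ℕ} (M : Matrix (Fin n) (Fin n) ℝ) (v : Eu n) : Eu n :=
  WithLp.toLp 2 (M *ᵥ v.ofLp)

/-- The normalising constant `γ_α` of the Riesz potential of order `α` on `ℝⁿ`. -/
noncomputable def rieszConst (n : ℕ) (α : ℝ) : ℝ :=
  2 ^ α * Real.pi ^ ((n : ℝ) / 2) * Real.Gamma (α / 2) / Real.Gamma (((n : ℝ) - α) / 2)

/-- The `s`-fractional gradient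
`∇ˢψ(x) = (n-1+s)/γ_{1-s} ∫ (ψ(x)-ψ(y)) (x-y) / |x-y|^{n+s+1} dy`.
It is used for test functions only, for which the integral converges absolutely. -/
noncomputable def fracGrad {n : ℕ} (s : ℝ) (ψ : Eu n → ℝ) (x : Eu n) : Eu n :=
  (((n : ℝ) - 1 + s) / rieszConst n (1 - s)) •
    ∫ y : Eu n, ((ψ x - ψ y) / ‖x - y‖ ^ ((n : ℝ) + s + 1)) • (x - y)

/-- `ψ ∈ C_c^∞(O)`. -/
def IsTestFunction {n : ℕ} (O : Set (Eu n)) (ψ : Eu n → ℝ) : Prop :=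
  ContDiff ℝ ∞ ψ ∧ HasCompactSupport ψ ∧ tsupport ψ ⊆ O

/-- The Hilbert space `L²(ℝⁿ) × L²(ℝⁿ; ℝⁿ)` with the norm `(‖u‖² + ‖G‖²)^{1/2}`. -/
abbrev L2Pair (n : ℕ) :=
  WithLp 2 (Lp ℝ 2 (volume : Measure (Eu n)) × Lp (Eu n) 2 (volume : Measure (Eu n)))

/-- The pairs `(ψ, ∇ˢψ)`, `ψ ∈ C_c^∞(O)`. -/
def testGraph {n : ℕ} (s : ℝ) (O : Set (Eu n)) : Set (L2Pair n) :=
  {p | ∃ ψ : Eu n → ℝ, IsTestFunction O ψ ∧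
    p.fst =ᵐ[volume] ψ ∧ p.snd =ᵐ[volume] fracGrad s ψ}

/-- The Hilbert space `H^s_0(O)`: the closure of `C_c^∞(O)` with respect to the norm
`(‖ψ‖²_{L²(ℝⁿ)} + ‖∇ˢψ‖²_{L²(ℝⁿ;ℝⁿ)})^{1/2}`. It is realised isometrically by identifying `u`
with the pair `(u, ∇ˢu)`; thus it is the closure of the graph of `∇ˢ` on `C_c^∞(O)`. (That
graph is a linear subspace, since `∇ˢ` is linear on test functions; taking its span changes
nothing and only supplies the structure of a submodule.) -/
noncomputable def HsZero {n : ℕ} (s : ℝ) (O : Set (Eu n)) : Submodule ℝ (L2Pair n) :=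
  (Submodule.span ℝ (testGraph s O)).topologicalClosure

/-- The extension of the fractional gradient to `H^s_0(O)`. -/
noncomputable def nablaS {n : ℕ} {s : ℝ} {O : Set (Eu n)} (u : HsZero s O) :
    Lp (Eu n) 2 (volume : Measure (Eu n)) :=
  (u : L2Pair n).snd

/-- `H^{-s}(O)`, the dual of `H^s_0(O)`. -/
abbrev HsDual {n : ℕ} (s : ℝ) (O : Set (Eu n)) := StrongDual ℝ (HsZero s O)

/-- The class `M(λ, Λ, ℝⁿ)` of Lebesgue measurable matrix fields with `Aξ·ξ ≥ λ|ξ|²` and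
`Aξ·ξ ≥ Λ⁻¹|Aξ|²` for all `ξ`, a.e. in `ℝⁿ`. -/
def MatrixClass {n : ℕ} (lam Lam : ℝ) : Set (Eu n → Matrix (Fin n) (Fin n) ℝ) :=
  {A | (∀ i j, AEMeasurable (fun x => A x i j) volume) ∧
    (∀ᵐ x ∂(volume : Measure (Eu n)), ∀ ξ : Eu n,
      lam * ‖ξ‖ ^ 2 ≤ inner ℝ (act (A x) ξ) ξ) ∧
    (∀ᵐ x ∂(volume : Measure (Eu n)), ∀ ξ : Eu n,
      Lam⁻¹ * ‖act (A x) ξ‖ ^ 2 ≤ inner ℝ (act (A x) ξ) ξ)}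

/-- The class `M(λ, Λ, Ω, A₀)` of those `A ∈ M(λ, Λ, ℝⁿ)` with `A = A₀` a.e. in `ℝⁿ \ Ω`. -/
def MatrixClassOn {n : ℕ} (lam Lam : ℝ) (Ω : Set (Eu n))
    (A₀ : Eu n → Matrix (Fin n) (Fin n) ℝ) : Set (Eu n → Matrix (Fin n) (Fin n) ℝ) :=
  {A | A ∈ MatrixClass lam Lam ∧ ∀ᵐ x ∂(volume : Measure (Eu n)), x ∉ Ω → A x = A₀ x}

/-- `u ∈ H^s_0(Ω)` is a weak solution of `-divˢ(A ∇ˢu) = f` in `Ω`, `u = 0` in `ℝⁿ \ Ω`. -/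
def IsWeakSolution {n : ℕ} {s : ℝ} {Ω : Set (Eu n)} (A : Eu n → Matrix (Fin n) (Fin n) ℝ)
    (f : HsDual s Ω) (u : HsZero s Ω) : Prop :=
  ∀ v : HsZero s Ω, ∫ x : Eu n, inner ℝ (act (A x) (nablaS u x)) (nablaS v x) = f v

/-- Nonlocal `H`-convergence in `H^s_0(Ω)` of matrix fields `A h` to `Ainf` (all of them in
classes `M(λ, Λ, ℝⁿ)`): for every `f ∈ H^{-s}(Ω)`, the weak solutions `u h` and `uinf` of the
problems with coefficients `A h` and `Ainf` satisfy `u h → uinf` weakly in `H^s_0(Ω)` and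
`A h ∇ˢ(u h) → Ainf ∇ˢ uinf` weakly in `L²(ℝⁿ; ℝⁿ)`. -/
def HConverges {n : ℕ} (s : ℝ) (Ω : Set (Eu n)) (A : ℕ → Eu n → Matrix (Fin n) (Fin n) ℝ)
    (Ainf : Eu n → Matrix (Fin n) (Fin n) ℝ) : Prop :=
  ∀ (f : HsDual s Ω) (u : ℕ → HsZero s Ω) (uinf : HsZero s Ω),
    (∀ h, IsWeakSolution (A h) f (u h)) → IsWeakSolution Ainf f uinf →
    (∀ ℓ : StrongDual ℝ (HsZero s Ω), Tendsto (fun h => ℓ (u h)) atTop (𝓝 (ℓ uinf))) ∧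
    (∀ Φ : Lp (Eu n) 2 (volume : Measure (Eu n)),
      Tendsto (fun h => ∫ x : Eu n, inner ℝ (act (A h x) (nablaS (u h) x)) (Φ x)) atTop
        (𝓝 (∫ x : Eu n, inner ℝ (act (Ainf x) (nablaS uinf x)) (Φ x))))

end FracH

/-! Let $u\in H^s_0(\Omega)$ be arbitrary and put $f=-\mathrm{div}^s(A_\infty\nabla^su)$, so that
$u$ itself is the weak solution for $A_\infty$. The weak solutions for $A_h$ with this $f$ converge
weakly to $u$ and also to the weak solution for $\widehat A_\infty$, so the two limits coincide.
Their fluxes also have a single weak limit, hence $A_\infty\nabla^su=\widehat A_\infty\nabla^su$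
a.e. This is `HConverges.act_nablaS_eq`.

It remains to see that the vectors $\nabla^su(x)$ determine the matrix at almost every $x\in\Omega$;
nonlocality makes this easy. If $\psi\ge0$ is a nonzero bump supported in the open half space
$\{(y-x)\cdot w>0\}$, then $\psi(x)=0$ and the integral for $\nabla^s\psi(x)\cdot w$ has an
integrand of one sign, so it does not vanish (`inner_fracGrad_ne_zero`). Countably many bumps, one
for each basic open subset of $\Omega$, serve all $x$ and $w$ at once
(`ae_eq_of_forall_act_fracGrad`). Outside $\Omega$ both limits equal $A_0$.

`HConverges` speaks only of given weak solutions, so their existence has to be proved. It follows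
from Lax–Milgram (`exists_isWeakSolution`), with coercivity supplied by a fractional Poincaré
inequality (`exists_poincare`). There the Fourier side is used: the symbol of $\nabla^s$ has size at
least $\kappa|\xi|^s$, which controls high frequencies, while low frequencies are controlled by
$\|\hat\psi\|_\infty\le\|\psi\|_{L^1}$ on a small ball and absorbed. -/

namespace FracH

/-! ### The fractional gradient of test functions: convergence, integrability, linearity -/

/-- The kernel `h / |h|^{n+s+1}` of the `s`-fractional gradient. -/
noncomputable def gradKer {n : ℕ} (s : ℝ) (h : Eu n) : Eu n :=
  (‖h‖ ^ ((n : ℝ) + s + 1))⁻¹ • h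

/-- The weight `min 1 |h| / |h|^{n+s}`. -/
noncomputable def kerWeight {n : ℕ} (s : ℝ) (h : Eu n) : ℝ :=
  min 1 ‖h‖ * (‖h‖ ^ ((n : ℝ) + s))⁻¹

lemma measurable_gradKer {n : ℕ} (s : ℝ) : Measurable (gradKer (n := n) s) := by
  unfold gradKer; fun_prop

lemma norm_gradKer {n : ℕ} {s : ℝ} (hs : 0 < s) (h : Eu n) :
    ‖gradKer s h‖ = (‖h‖ ^ ((n : ℝ) + s))⁻¹ := by
  rcases eq_or_ne h 0 with rfl | hh
  · have : (n : ℝ) + s ≠ 0 := by positivity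
    simp [gradKer, Real.zero_rpow this]
  · have h0 : 0 < ‖h‖ := norm_pos_iff.2 hh
    rw [gradKer, norm_smul, norm_inv, Real.norm_of_nonneg (by positivity),
      Real.rpow_add h0 _ 1, Real.rpow_one]
    field_simp

/-- In polar coordinates the Jacobian $r^{n-1}$ leaves $\min(1,r)\,r^{-1-s}$: this is $r^{-s}$ near
$0$, integrable as $s<1$, and $r^{-1-s}$ at infinity, integrable as $s>0$. -/
lemma integrable_kerWeight {n : ℕ} (hn : 2 ≤ n) {s : ℝ} (hs0 : 0 < s) (hs1 : s < 1) :
    Integrable (kerWeight (n := n) s) volume := by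
  have : Nontrivial (Eu n) := by
    have : Nonempty (Fin n) := ⟨⟨0, by omega⟩⟩
    infer_instance
  refine (integrable_fun_norm_addHaar (volume : Measure (Eu n))
    (f := fun r => min 1 r * (r ^ ((n : ℝ) + s))⁻¹)).2 ?_
  have key : ∀ y : ℝ, 0 < y → y ^ (n - 1) • (min 1 y * (y ^ ((n : ℝ) + s))⁻¹) =
      min 1 y * y ^ (-1 - s) := by
    intro y hy
    rw [← Real.rpow_natCast, ← Real.rpow_neg hy.le, smul_eq_mul, mul_left_comm,
      ← Real.rpow_add hy]
    congr 2
    push_cast [Nat.cast_sub (show 1 ≤ n by omega)]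
    ring
  rw [finrank_euclideanSpace_fin, ← Set.Ioc_union_Ioi_eq_Ioi (zero_le_one' ℝ)]
  refine IntegrableOn.union ?_ ?_
  · have h1 : IntegrableOn (fun y : ℝ => y ^ (-s)) (Set.Ioc 0 1) volume :=
      (intervalIntegrable_iff_integrableOn_Ioc_of_le zero_le_one).1
        (intervalIntegral.intervalIntegrable_rpow' (by linarith))
    refine h1.congr_fun (fun y hy => ?_) measurableSet_Ioc
    dsimp only
    rw [key y hy.1, min_eq_right hy.2]
    nth_rw 2 [← Real.rpow_one y]
    rw [← Real.rpow_add hy.1]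
    congr 1; ring
  · have h1 : IntegrableOn (fun y : ℝ => y ^ (-1 - s)) (Set.Ioi 1) volume :=
      integrableOn_Ioi_rpow_of_lt (by linarith) one_pos
    refine h1.congr_fun (fun y hy => ?_) measurableSet_Ioi
    dsimp only
    rw [key y (one_pos.trans hy), min_eq_left (le_of_lt hy), one_mul]

/-- Substituting $y=x-h$ frees the kernel from $x$, which is the form needed for domination and for
Fubini. -/
lemma fracGrad_eq {n : ℕ} (s : ℝ) (ψ : Eu n → ℝ) (x : Eu n) :
    fracGrad s ψ x = (((n : ℝ) - 1 + s) / rieszConst n (1 - s)) •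
      ∫ h : Eu n, (ψ x - ψ (x - h)) • gradKer s h := by
  rw [fracGrad, ← integral_sub_left_eq_self _ _ x]
  congr 2
  ext1 y
  rw [gradKer, smul_smul, sub_sub_cancel, div_eq_mul_inv]

lemma fracGrad_const_pos {n : ℕ} (hn : 2 ≤ n) {s : ℝ} (hs0 : 0 < s) (hs1 : s < 1) :
    0 < ((n : ℝ) - 1 + s) / rieszConst n (1 - s) := by
  have hn' : (2 : ℝ) ≤ n := by exact_mod_cast hn
  refine div_pos (by linarith) ?_
  unfold rieszConst
  have := Real.Gamma_pos_of_pos (show 0 < (1 - s) / 2 by linarith)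
  have := Real.Gamma_pos_of_pos (show 0 < ((n : ℝ) - (1 - s)) / 2 by linarith)
  have := Real.pi_pos
  positivity

namespace IsTestFunction

variable {n : ℕ} {O : Set (Eu n)} {ψ φ : Eu n → ℝ}

lemma continuous (h : IsTestFunction O ψ) : Continuous ψ := h.1.continuous

lemma add (hψ : IsTestFunction O ψ) (hφ : IsTestFunction O φ) : IsTestFunction O (ψ + φ) :=
  ⟨hψ.1.add hφ.1, hψ.2.1.add hφ.2.1,
    (tsupport_add ψ φ).trans (Set.union_subset hψ.2.2 hφ.2.2)⟩

lemma const_smul (hψ : IsTestFunction O ψ) (c : ℝ) : IsTestFunction O (c • ψ) :=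
  ⟨contDiff_const.smul hψ.1, hψ.2.1.smul_left (f := fun _ => c),
    (closure_mono (Function.support_const_smul_subset c ψ)).trans hψ.2.2⟩

lemma zero : IsTestFunction O (0 : Eu n → ℝ) :=
  ⟨contDiff_const, HasCompactSupport.zero, by simp⟩

lemma integrable (h : IsTestFunction O ψ) : Integrable ψ volume :=
  h.continuous.integrable_of_hasCompactSupport h.2.1

lemma memLp (h : IsTestFunction O ψ) : MemLp ψ 2 volume :=
  h.continuous.memLp_of_hasCompactSupport h.2.1

/-- Differences of a test function are controlled by `min 1 |h|`, with support control. -/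
lemma exists_norm_sub_le (hψ : IsTestFunction O ψ) :
    ∃ C : ℝ, 0 ≤ C ∧ ∀ x h : Eu n, |ψ x - ψ (x - h)| ≤ C * min 1 ‖h‖ *
      ((tsupport ψ).indicator 1 x + (tsupport ψ).indicator 1 (x - h)) := by
  obtain ⟨L, hL⟩ := ContDiff.lipschitzWith_of_hasCompactSupport hψ.2.1 hψ.1 (by simp)
  obtain ⟨M, hM⟩ := hψ.continuous.bounded_above_of_compact_support hψ.2.1
  have hM0 : 0 ≤ M := (norm_nonneg _).trans (hM 0)
  have bd : ∀ x h : Eu n, |ψ x - ψ (x - h)| ≤ (L + 2 * M) * min 1 ‖h‖ := by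
    intro x h
    rcases le_total 1 ‖h‖ with h1 | h1
    · rw [min_eq_left h1, mul_one]
      have := norm_sub_le (ψ x) (ψ (x - h))
      rw [Real.norm_eq_abs] at this
      linarith [hM x, hM (x - h), L.2, show (0 : ℝ) ≤ L from L.2]
    · rw [min_eq_right h1]
      have := hL.norm_sub_le x (x - h)
      rw [sub_sub_cancel, Real.norm_eq_abs] at this
      nlinarith [norm_nonneg h]
  refine ⟨L + 2 * M, by positivity, fun x h => ?_⟩
  by_cases hx : x ∈ tsupport ψ
  · refine (bd x h).trans (le_mul_of_one_le_right (by positivity) ?_)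
    have : (0 : ℝ) ≤ (tsupport ψ).indicator 1 (x - h) :=
      Set.indicator_nonneg (fun _ _ => zero_le_one) _
    simp [hx, this]
  · by_cases hxh : x - h ∈ tsupport ψ
    · simpa [hx, hxh] using bd x h
    · simp [hx, hxh, image_eq_zero_of_notMem_tsupport]

variable {s : ℝ}

lemma aestronglyMeasurable_integrand (hψ : IsTestFunction O ψ) :
    AEStronglyMeasurable (fun p : Eu n × Eu n => (ψ p.1 - ψ (p.1 - p.2)) • gradKer s p.2)
      ((volume : Measure (Eu n)).prod volume) := by
  have h1 : Measurable (fun p : Eu n × Eu n => gradKer s p.2) :=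
    (measurable_gradKer s).comp measurable_snd
  have h2 : Continuous (fun p : Eu n × Eu n => ψ p.1 - ψ (p.1 - p.2)) := by
    have := hψ.continuous
    fun_prop
  exact (h2.measurable.smul h1).aestronglyMeasurable

/-- Of the two indicators in the bound of `exists_norm_sub_le`, the one at $x$ gives a product of
integrable functions and the one at $x-h$ a convolution integrand. -/
lemma integrable_integrand_prod (hn : 2 ≤ n) (hs0 : 0 < s) (hs1 : s < 1)
    (hψ : IsTestFunction O ψ) :
    Integrable (fun p : Eu n × Eu n => (ψ p.1 - ψ (p.1 - p.2)) • gradKer s p.2)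
      ((volume : Measure (Eu n)).prod volume) := by
  obtain ⟨C, hC0, hC⟩ := hψ.exists_norm_sub_le
  have hI : Integrable ((tsupport ψ).indicator (1 : Eu n → ℝ)) volume :=
    (integrable_indicator_iff hψ.2.1.isCompact.measurableSet).2
      (integrableOn_const hψ.2.1.isCompact.measure_lt_top.ne)
  have hW := integrable_kerWeight hn hs0 hs1
  have h1 := (hI.mul_prod hW).add
    (hW.convolution_integrand (ContinuousLinearMap.mul ℝ ℝ) hI)
  refine (h1.const_mul C).mono' hψ.aestronglyMeasurable_integrand (ae_of_all _ fun p => ?_)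
  have hinv : 0 ≤ (‖p.2‖ ^ ((n : ℝ) + s))⁻¹ := by positivity
  rw [norm_smul, norm_gradKer hs0, Real.norm_eq_abs]
  refine (mul_le_mul_of_nonneg_right (hC p.1 p.2) hinv).trans_eq ?_
  simp only [kerWeight, Pi.add_apply, ContinuousLinearMap.mul_apply']
  ring

lemma norm_integrand_le (hs0 : 0 < s) (hψ : IsTestFunction O ψ) :
    ∃ C : ℝ, 0 ≤ C ∧ ∀ x h : Eu n,
      ‖(ψ x - ψ (x - h)) • gradKer s h‖ ≤ C * kerWeight s h := by
  obtain ⟨C, hC0, hC⟩ := hψ.exists_norm_sub_le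
  refine ⟨C * 2, by positivity, fun x h => ?_⟩
  have hinv : 0 ≤ (‖h‖ ^ ((n : ℝ) + s))⁻¹ := by positivity
  rw [norm_smul, norm_gradKer hs0, Real.norm_eq_abs, kerWeight, ← mul_assoc]
  refine mul_le_mul_of_nonneg_right ((hC x h).trans ?_) hinv
  have hle : ∀ y : Eu n, (tsupport ψ).indicator (1 : Eu n → ℝ) y ≤ 1 := fun y =>
    Set.indicator_le_self' (fun _ _ => zero_le_one) y
  have : 0 ≤ C * min 1 ‖h‖ := by positivity
  nlinarith [hle x, hle (x - h)]

lemma integrable_integrand (hn : 2 ≤ n) (hs0 : 0 < s) (hs1 : s < 1)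
    (hψ : IsTestFunction O ψ) (x : Eu n) :
    Integrable (fun h : Eu n => (ψ x - ψ (x - h)) • gradKer s h) volume := by
  obtain ⟨C, -, hC⟩ := hψ.norm_integrand_le hs0
  refine ((integrable_kerWeight hn hs0 hs1).const_mul C).mono' ?_ (ae_of_all _ (hC x))
  have h2 : Continuous (fun h : Eu n => ψ x - ψ (x - h)) := by
    have := hψ.continuous
    fun_prop
  exact (h2.measurable.smul (measurable_gradKer s)).aestronglyMeasurable

lemma integrable_fracGrad (hn : 2 ≤ n) (hs0 : 0 < s) (hs1 : s < 1)
    (hψ : IsTestFunction O ψ) : Integrable (fracGrad s ψ) volume := by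
  have := (hψ.integrable_integrand_prod hn hs0 hs1).integral_prod_left.smul
    (((n : ℝ) - 1 + s) / rieszConst n (1 - s))
  exact this.congr (ae_of_all _ fun x => (fracGrad_eq s ψ x).symm)

lemma memLp_fracGrad (hn : 2 ≤ n) (hs0 : 0 < s) (hs1 : s < 1)
    (hψ : IsTestFunction O ψ) : MemLp (fracGrad s ψ) 2 volume := by
  have hI := hψ.integrable_fracGrad hn hs0 hs1
  obtain ⟨C, hC0, hC⟩ := hψ.norm_integrand_le hs0
  set c := ((n : ℝ) - 1 + s) / rieszConst n (1 - s) with hc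
  have hbd : ∀ x, ‖fracGrad s ψ x‖ ≤ |c| * ∫ h : Eu n, C * kerWeight s h := by
    intro x
    rw [fracGrad_eq, norm_smul, Real.norm_eq_abs]
    refine mul_le_mul_of_nonneg_left ?_ (abs_nonneg c)
    exact norm_integral_le_of_norm_le ((integrable_kerWeight hn hs0 hs1).const_mul C)
      (ae_of_all _ (hC x))
  rw [memLp_two_iff_integrable_sq_norm hI.1]
  refine (hI.norm.const_mul (|c| * ∫ h : Eu n, C * kerWeight s h)).mono'
    (hI.1.norm.pow 2) (ae_of_all _ fun x => ?_)
  rw [Real.norm_of_nonneg (by positivity), sq]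
  exact mul_le_mul_of_nonneg_right (hbd x) (norm_nonneg _)

end IsTestFunction

lemma fracGrad_add {n : ℕ} (hn : 2 ≤ n) {s : ℝ} (hs0 : 0 < s) (hs1 : s < 1) {O : Set (Eu n)}
    {ψ φ : Eu n → ℝ} (hψ : IsTestFunction O ψ) (hφ : IsTestFunction O φ) :
    fracGrad s (ψ + φ) = fracGrad s ψ + fracGrad s φ := by
  ext1 x
  rw [Pi.add_apply, fracGrad_eq, fracGrad_eq, fracGrad_eq, ← smul_add,
    ← integral_add (hψ.integrable_integrand hn hs0 hs1 x) (hφ.integrable_integrand hn hs0 hs1 x)]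
  congr 2
  ext1 h
  rw [← add_smul, Pi.add_apply, Pi.add_apply]
  congr 1
  ring

lemma fracGrad_const_smul {n : ℕ} (s c : ℝ) (ψ : Eu n → ℝ) :
    fracGrad s (c • ψ) = c • fracGrad s ψ := by
  ext1 x
  rw [Pi.smul_apply, fracGrad_eq, fracGrad_eq, smul_comm c, ← integral_smul c]
  congr 2
  ext1 h
  rw [Pi.smul_apply, Pi.smul_apply, ← smul_sub, smul_assoc]

/-- The graph of `∇ˢ` on test functions is its own span. -/
lemma span_testGraph_subset {n : ℕ} (hn : 2 ≤ n) {s : ℝ} (hs0 : 0 < s) (hs1 : s < 1)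
    (O : Set (Eu n)) : (Submodule.span ℝ (testGraph s O) : Set (L2Pair n)) ⊆ testGraph s O := by
  intro p hp
  induction hp using Submodule.span_induction with
  | mem p hp => exact hp
  | zero =>
    refine ⟨0, IsTestFunction.zero, Lp.coeFn_zero _ _ _, ?_⟩
    refine (Lp.coeFn_zero _ _ _).trans (ae_of_all _ fun x => ?_)
    simp [fracGrad]
  | add p q _ _ hp hq =>
    obtain ⟨ψ, hψ, h1, h2⟩ := hp
    obtain ⟨φ, hφ, h3, h4⟩ := hq
    refine ⟨ψ + φ, hψ.add hφ, (Lp.coeFn_add _ _).trans (h1.add h3), ?_⟩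
    rw [fracGrad_add hn hs0 hs1 hψ hφ]
    exact (Lp.coeFn_add _ _).trans (h2.add h4)
  | smul c p _ hp =>
    obtain ⟨ψ, hψ, h1, h2⟩ := hp
    refine ⟨c • ψ, hψ.const_smul c, (Lp.coeFn_smul _ _).trans (h1.const_smul c), ?_⟩
    rw [fracGrad_const_smul]
    exact (Lp.coeFn_smul _ _).trans (h2.const_smul c)

/-! ### The symbol of the fractional gradient: homogeneity, rotation invariance, positivity -/

/-- Up to the factor `i / |ξ|`, the symbol of the `s`-fractional gradient in the direction `ξ`. -/
noncomputable def sinSymbol {n : ℕ} (s : ℝ) (ξ : Eu n) : ℝ :=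
  ∫ h : Eu n, inner ℝ (gradKer s h) ξ * Real.sin (2 * Real.pi * inner ℝ h ξ)

/-- The integrand of the symbol of the fractional Laplacian of order `1 + s`. -/
noncomputable def cosIntegrand {n : ℕ} (s : ℝ) (ξ h : Eu n) : ℝ :=
  (1 - Real.cos (2 * Real.pi * inner ℝ h ξ)) * (‖h‖ ^ ((n : ℝ) + s + 1))⁻¹

lemma gradKer_smul {n : ℕ} (s : ℝ) {t : ℝ} (ht : 0 < t) (h : Eu n) :
    gradKer s (t • h) = (t ^ ((n : ℝ) + s))⁻¹ • gradKer s h := by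
  rw [gradKer, gradKer, norm_smul, Real.norm_of_nonneg ht.le,
    Real.mul_rpow ht.le (norm_nonneg h), smul_smul, smul_smul, Real.rpow_add ht _ 1, Real.rpow_one]
  congr 1
  field_simp

lemma gradKer_map {n : ℕ} (s : ℝ) (L : Eu n ≃ₗᵢ[ℝ] Eu n) (h : Eu n) :
    gradKer s (L h) = L (gradKer s h) := by
  simp [gradKer]

lemma integral_comp_pos_smul {n : ℕ} (f : Eu n → ℝ) {t : ℝ} (ht : 0 < t) :
    ∫ h, f (t • h) = (t ^ (n : ℝ))⁻¹ * ∫ h, f h := by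
  rw [Measure.integral_comp_smul, finrank_euclideanSpace_fin, abs_of_pos (by positivity),
    Real.rpow_natCast, smul_eq_mul]

lemma sinSymbol_smul {n : ℕ} (s : ℝ) {t : ℝ} (ht : 0 < t) (ξ : Eu n) :
    sinSymbol s (t • ξ) = t ^ (1 + s) * sinSymbol s ξ := by
  have h1 : ∀ h : Eu n, inner ℝ (gradKer s h) (t • ξ) *
      Real.sin (2 * Real.pi * inner ℝ h (t • ξ)) = t ^ ((n : ℝ) + (1 + s)) *
      (inner ℝ (gradKer s (t • h)) ξ * Real.sin (2 * Real.pi * inner ℝ (t • h) ξ)) := by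
    intro h
    rw [gradKer_smul s ht, real_inner_smul_right, real_inner_smul_right, real_inner_smul_left,
      real_inner_smul_left, show (n : ℝ) + (1 + s) = n + s + 1 by ring, Real.rpow_add ht _ 1,
      Real.rpow_one]
    field_simp
  simp only [sinSymbol, h1]
  rw [integral_const_mul, integral_comp_pos_smul
    (fun h => inner ℝ (gradKer s h) ξ * Real.sin (2 * Real.pi * inner ℝ h ξ)) ht,
    Real.rpow_add ht]
  have : t ^ (n : ℝ) ≠ 0 := by positivity
  field_simp

lemma sinSymbol_map {n : ℕ} (s : ℝ) (L : Eu n ≃ₗᵢ[ℝ] Eu n) (ξ : Eu n) :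
    sinSymbol s (L ξ) = sinSymbol s ξ := by
  rw [sinSymbol, ← L.measurePreserving.integral_comp L.toHomeomorph.measurableEmbedding]
  simp [sinSymbol, gradKer_map]

lemma integral_cosIntegrand_smul {n : ℕ} (s : ℝ) {t : ℝ} (ht : 0 < t) (ξ : Eu n) :
    ∫ h, cosIntegrand s (t • ξ) h = t ^ (1 + s) * ∫ h, cosIntegrand s ξ h := by
  have h1 : ∀ h : Eu n, cosIntegrand s (t • ξ) h =
      t ^ ((n : ℝ) + (1 + s)) * cosIntegrand s ξ (t • h) := by
    intro h
    rw [cosIntegrand, cosIntegrand, real_inner_smul_right, real_inner_smul_left, norm_smul,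
      Real.norm_of_nonneg ht.le, Real.mul_rpow ht.le (norm_nonneg h),
      show (n : ℝ) + (1 + s) = n + s + 1 by ring, mul_inv]
    field_simp
  simp only [h1]
  rw [integral_const_mul, integral_comp_pos_smul (cosIntegrand s ξ) ht, Real.rpow_add ht]
  have : t ^ (n : ℝ) ≠ 0 := by positivity
  field_simp

lemma norm_mul_inv_rpow {n : ℕ} {s : ℝ} (hs0 : 0 < s) (h : Eu n) :
    ‖h‖ * (‖h‖ ^ ((n : ℝ) + s + 1))⁻¹ = (‖h‖ ^ ((n : ℝ) + s))⁻¹ := by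
  rw [← norm_gradKer hs0, gradKer, norm_smul, norm_inv, Real.norm_of_nonneg (by positivity),
    mul_comm]

lemma min_one_mul_le {a b : ℝ} (ha : 1 ≤ a) : min 1 (a * b) ≤ a * min 1 b := by
  rcases le_total 1 b with h | h
  · rw [min_eq_left h, mul_one]
    exact (min_le_left _ _).trans ha
  · rw [min_eq_right h]
    exact min_le_right _ _

lemma abs_sin_le_min (x : ℝ) : |Real.sin x| ≤ min 1 |x| :=
  le_min (Real.abs_sin_le_one x) Real.abs_sin_le_abs

lemma measurable_cosIntegrand {n : ℕ} (s : ℝ) (ξ : Eu n) : Measurable (cosIntegrand s ξ) := by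
  unfold cosIntegrand; fun_prop

lemma cosIntegrand_nonneg {n : ℕ} (s : ℝ) (ξ h : Eu n) : 0 ≤ cosIntegrand s ξ h :=
  mul_nonneg (sub_nonneg.2 (Real.cos_le_one _)) (by positivity)

lemma integrable_cosIntegrand {n : ℕ} (hn : 2 ≤ n) {s : ℝ} (hs0 : 0 < s) (hs1 : s < 1)
    {e : Eu n} (he : ‖e‖ = 1) : Integrable (cosIntegrand s e) volume := by
  refine ((integrable_kerWeight hn hs0 hs1).const_mul (2 * Real.pi ^ 2)).mono'
    (measurable_cosIntegrand s e).aestronglyMeasurable (ae_of_all _ fun h => ?_)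
  rw [Real.norm_of_nonneg (cosIntegrand_nonneg s e h), cosIntegrand, kerWeight,
    ← norm_mul_inv_rpow hs0, ← mul_assoc, ← mul_assoc]
  refine mul_le_mul_of_nonneg_right ?_ (by positivity)
  have hpi := Real.pi_gt_three
  have hin : (inner ℝ h e) ^ 2 ≤ ‖h‖ ^ 2 := by
    rw [sq_le_sq, abs_norm]
    simpa [he] using abs_real_inner_le_norm h e
  rcases le_total 1 ‖h‖ with h1 | h1
  · rw [min_eq_left h1, mul_one]
    have := Real.neg_one_le_cos (2 * Real.pi * inner ℝ h e)
    nlinarith [mul_le_mul (show (1 : ℝ) ≤ Real.pi ^ 2 by nlinarith) h1 zero_le_one (by positivity)]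
  · rw [min_eq_right h1]
    have := Real.one_sub_sq_div_two_le_cos (x := 2 * Real.pi * inner ℝ h e)
    nlinarith [mul_le_mul_of_nonneg_left hin (show 0 ≤ 2 * Real.pi ^ 2 by positivity)]

/-- The integrand of `sinSymbol` changes sign, so its positivity is not visible directly. It is,
however, up to the factor $2\pi$, the radial derivative of the nonnegative integrand $(1-\cos(2\pi
h\cdot\xi))|h|^{-n-s-1}$. -/
lemma hasDerivAt_integral_cosIntegrand {n : ℕ} (hn : 2 ≤ n) {s : ℝ} (hs0 : 0 < s) (hs1 : s < 1)
    {e : Eu n} (he : ‖e‖ = 1) :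
    HasDerivAt (fun t : ℝ => ∫ h, cosIntegrand s (t • e) h)
      (2 * Real.pi * sinSymbol s e) 1 := by
  have hpi := Real.pi_gt_three
  -- On the ball of radius 1 about 1 one has $0<t<2$; this produces the $4\pi$ in the dominating
  -- function.
  have key := hasDerivAt_integral_of_dominated_loc_of_deriv_le (μ := (volume : Measure (Eu n)))
    (F := fun (t : ℝ) h => cosIntegrand s (t • e) h) (x₀ := (1 : ℝ)) (s := Metric.ball 1 1)
    (F' := fun t h => Real.sin (2 * Real.pi * inner ℝ h (t • e)) * (2 * Real.pi * inner ℝ h e) *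
      (‖h‖ ^ ((n : ℝ) + s + 1))⁻¹)
    (bound := fun h => (2 * Real.pi * (4 * Real.pi)) * kerWeight s h)
    (Metric.ball_mem_nhds _ one_pos)
    (Eventually.of_forall fun t => (measurable_cosIntegrand s _).aestronglyMeasurable)
    (by simpa using integrable_cosIntegrand hn hs0 hs1 he)
    (by
      refine Measurable.aestronglyMeasurable ?_
      fun_prop)
    (ae_of_all _ fun h t ht => ?_)
    ((integrable_kerWeight hn hs0 hs1).const_mul _)
    (ae_of_all _ fun h t ht => ?_)
  · refine key.2.congr_deriv (Eq.symm ?_)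
    rw [sinSymbol, ← integral_const_mul]
    congr 1
    ext1 h
    rw [gradKer, real_inner_smul_left, one_smul]
    ring
  · rw [Metric.mem_ball, Real.dist_eq, abs_lt] at ht
    have hin : |inner ℝ h e| ≤ ‖h‖ := by simpa [he] using abs_real_inner_le_norm h e
    have h1 : |Real.sin (2 * Real.pi * inner ℝ h (t • e))| ≤ 4 * Real.pi * min 1 ‖h‖ := by
      refine (abs_sin_le_min _).trans (le_trans ?_ (min_one_mul_le (by linarith)))
      refine min_le_min_left _ ?_
      rw [real_inner_smul_right, abs_mul, abs_mul, abs_mul, abs_of_pos Real.pi_pos,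
        abs_of_pos (show t > 0 by linarith), abs_two]
      have := mul_le_mul (show t ≤ 2 by linarith) hin (abs_nonneg _) (by norm_num)
      nlinarith
    rw [norm_mul, norm_mul, norm_inv, Real.norm_of_nonneg (show 0 ≤ ‖h‖ ^ ((n : ℝ) + s + 1) by
      positivity), Real.norm_eq_abs, Real.norm_eq_abs, kerWeight, ← norm_mul_inv_rpow hs0,
      ← mul_assoc, ← mul_assoc]
    refine mul_le_mul_of_nonneg_right ?_ (by positivity)
    rw [abs_mul, abs_of_pos (show 0 < 2 * Real.pi by positivity)]
    calc _ ≤ (4 * Real.pi * min 1 ‖h‖) * (2 * Real.pi * ‖h‖) := by gcongr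
      _ = _ := by ring
  · have h1 : HasDerivAt (fun t : ℝ => 2 * Real.pi * inner ℝ h (t • e))
        (2 * Real.pi * inner ℝ h e) t := by
      simp only [real_inner_smul_right]
      simpa using ((hasDerivAt_id t).mul_const (inner ℝ h e)).const_mul (2 * Real.pi)
    have h2 := (h1.cos.const_sub 1).mul_const (‖h‖ ^ ((n : ℝ) + s + 1))⁻¹
    simpa [cosIntegrand] using h2

/-- Euler's identity for a function homogeneous of degree $1+s$: computing the radial derivative of
the cosine integral in two ways gives $2\pi\,$`sinSymbol`$=(1+s)\int$`cosIntegrand`, and the right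
side is positive. -/
lemma sinSymbol_pos_of_norm_eq_one {n : ℕ} (hn : 2 ≤ n) {s : ℝ} (hs0 : 0 < s) (hs1 : s < 1)
    {e : Eu n} (he : ‖e‖ = 1) : 0 < sinSymbol s e := by
  have hR : 0 < ∫ h, cosIntegrand s e h := by
    rw [integral_pos_iff_support_of_nonneg (cosIntegrand_nonneg s e)
      (integrable_cosIntegrand hn hs0 hs1 he)]
    have hcont : Continuous fun h : Eu n => Real.cos (2 * Real.pi * inner ℝ h e) := by fun_prop
    have hopen : IsOpen {h : Eu n | h ≠ 0 ∧ Real.cos (2 * Real.pi * inner ℝ h e) < 1} :=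
      isOpen_ne.inter (isOpen_lt hcont continuous_const)
    -- The point $e/2$ lies in this open set, since the cosine there is $\cos\pi=-1$.
    refine (hopen.measure_pos volume ⟨(2⁻¹ : ℝ) • e, ?_, ?_⟩).trans_le (measure_mono ?_)
    · rw [← norm_pos_iff, norm_smul, he]; norm_num
    · rw [real_inner_smul_left, real_inner_self_eq_norm_sq, he,
        show 2 * Real.pi * (2⁻¹ * 1 ^ 2) = Real.pi by ring, Real.cos_pi]
      norm_num
    · rintro h ⟨h0, h1⟩
      have : 0 < ‖h‖ := norm_pos_iff.2 h0
      exact (mul_pos (sub_pos.2 h1) (by positivity)).ne'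
  have hd := hasDerivAt_integral_cosIntegrand hn hs0 hs1 he
  have hd' : HasDerivAt (fun t : ℝ => ∫ h, cosIntegrand s (t • e) h)
      ((1 + s) * ∫ h, cosIntegrand s e h) 1 := by
    have h1 := (Real.hasDerivAt_rpow_const (x := 1) (p := 1 + s) (Or.inl one_ne_zero)).mul_const
      (∫ h, cosIntegrand s e h)
    simp only [Real.one_rpow, mul_one] at h1
    refine h1.congr_of_eventuallyEq ?_
    filter_upwards [lt_mem_nhds (zero_lt_one' ℝ)] with t ht
    exact integral_cosIntegrand_smul s ht e
  have heq := hd.unique hd'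
  have : 0 < 2 * Real.pi * sinSymbol s e := heq ▸ mul_pos (by linarith) hR
  exact (mul_pos_iff_of_pos_left (by positivity)).1 this

/-- The symbol of the `s`-fractional gradient is bounded below by a multiple of `|ξ|^s`. -/
lemma exists_sinSymbol_eq {n : ℕ} (hn : 2 ≤ n) {s : ℝ} (hs0 : 0 < s) (hs1 : s < 1) :
    ∃ κ : ℝ, 0 < κ ∧ ∀ ξ : Eu n, ξ ≠ 0 → sinSymbol s ξ = κ * ‖ξ‖ ^ (1 + s) := by
  obtain ⟨e, he⟩ : ∃ e : Eu n, ‖e‖ = 1 :=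
    ⟨EuclideanSpace.single ⟨0, by omega⟩ 1, by simp⟩
  refine ⟨sinSymbol s e, sinSymbol_pos_of_norm_eq_one hn hs0 hs1 he, fun ξ hξ => ?_⟩
  have h0 : 0 < ‖ξ‖ := norm_pos_iff.2 hξ
  set e' : Eu n := ‖ξ‖⁻¹ • ξ with he'
  have he'1 : ‖e'‖ = ‖e‖ := by rw [he', he, norm_smul, norm_inv, norm_norm, inv_mul_cancel₀ h0.ne']
  have hξe' : ξ = ‖ξ‖ • e' := by rw [he', smul_smul, mul_inv_cancel₀ h0.ne', one_smul]
  -- The reflection in the hyperplane orthogonal to $e'-e$ carries the unit vector $e'$ to $e$, so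
  -- the symbol takes the same value at both.
  rw [hξe', sinSymbol_smul s h0, ← hξe', mul_comm, ← Submodule.reflection_sub he'1, sinSymbol_map]

/-! ### Fourier transform and Plancherel on $L^1\cap L^2$ -/

open FourierTransform in
/-- On `L¹ ∩ L²` the `L²`-Fourier transform is given by the Fourier integral. -/
lemma coeFn_fourier_toLp {E : Type*} [NormedAddCommGroup E] [InnerProductSpace ℝ E]
    [FiniteDimensional ℝ E] [MeasurableSpace E] [BorelSpace E] {f : E → ℂ}
    (hf : Integrable f volume) (hf2 : MemLp f 2 volume) :
    (𝓕 (hf2.toLp f) : Lp ℂ 2 (volume : Measure E)) =ᵐ[volume] 𝓕 f := by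
  set u : Lp ℂ 2 (volume : Measure E) := 𝓕 (hf2.toLp f) with hu
  have hcont : Continuous (𝓕 f) := VectorFourier.fourierIntegral_continuous
    Real.continuous_fourierChar (by exact continuous_inner) hf
  -- Both transforms define the same tempered distribution: in each case the transform can be moved
  -- onto the Schwartz function.
  have hpair : ∀ g : SchwartzMap E ℂ, ∫ x, g x • u x = ∫ x, g x • 𝓕 f x := by
    intro g
    have h1 := congrArg (fun T => T g) (Lp.fourier_toTemperedDistribution_eq (hf2.toLp f))
    simp only [TemperedDistribution.fourier_apply, Lp.toTemperedDistribution_apply] at h1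
    rw [hu, ← h1]
    have h2 : ∫ x, 𝓕 g x • hf2.toLp f x = ∫ x, 𝓕 g x • f x :=
      integral_congr_ae (by filter_upwards [hf2.coeFn_toLp] with x hx; rw [hx])
    rw [h2]
    exact (VectorFourier.integral_fourierIntegral_smul_eq_flip (L := innerₗ E)
      Real.continuous_fourierChar continuous_inner g.integrable hf).trans (by
        rw [flip_innerₗ]; rfl)
  have hloc : LocallyIntegrable (fun x => u x - 𝓕 f x) volume :=
    ((Lp.memLp u).locallyIntegrable (by norm_num)).sub hcont.locallyIntegrable
  -- Smooth compactly supported functions are Schwartz, so the fundamental lemma of the calculus of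
  -- variations applies to the difference.
  have hz := ae_eq_zero_of_integral_contDiff_smul_eq_zero hloc fun g hg hgc => by
    have hgc' : HasCompactSupport (fun x => (g x : ℂ)) := hgc.comp_left Complex.ofReal_zero
    have hg' : ContDiff ℝ ∞ (fun x => (g x : ℂ)) := Complex.ofRealCLM.contDiff.comp hg
    have h3 := hpair (hgc'.toSchwartzMap hg')
    have h4 : ∀ x, (hgc'.toSchwartzMap hg') x = (g x : ℂ) := fun x => rfl
    simp only [h4, smul_eq_mul] at h3
    have i1 : Integrable (fun x => (g x : ℂ) * u x) volume := by
      simpa [Complex.real_smul] using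
        ((Lp.memLp u).locallyIntegrable (by norm_num)).integrable_smul_left_of_hasCompactSupport
          hg.continuous hgc
    have i2 : Integrable (fun x => (g x : ℂ) * 𝓕 f x) volume := by
      simpa [Complex.real_smul] using
        hcont.locallyIntegrable.integrable_smul_left_of_hasCompactSupport hg.continuous hgc
    simp only [Complex.real_smul, mul_sub]
    rw [integral_sub i1 i2, h3, sub_self]
  filter_upwards [hz] with x hx using sub_eq_zero.1 hx

open FourierTransform in
/-- Plancherel's theorem for `L¹ ∩ L²`. -/
lemma plancherel_of_integrable_memLp {E : Type*} [NormedAddCommGroup E] [InnerProductSpace ℝ E]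
    [FiniteDimensional ℝ E] [MeasurableSpace E] [BorelSpace E] {f : E → ℂ}
    (hf : Integrable f volume) (hf2 : MemLp f 2 volume) :
    Integrable (fun ξ => ‖𝓕 f ξ‖ ^ 2) volume ∧ ∫ ξ, ‖𝓕 f ξ‖ ^ 2 = ∫ x, ‖f x‖ ^ 2 := by
  have hae := coeFn_fourier_toLp hf hf2
  have hm : MemLp (𝓕 f) 2 volume := (memLp_congr_ae hae).1 (Lp.memLp _)
  refine ⟨(memLp_two_iff_integrable_sq_norm hm.1).1 hm, ?_⟩
  have key : ∀ v : Lp ℂ 2 (volume : Measure E), ‖v‖ ^ 2 = ∫ x, ‖v x‖ ^ 2 := fun v => by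
    rw [← inner_self_eq_norm_sq (𝕜 := ℂ), L2.inner_def, ← integral_re (L2.integrable_inner v v)]
    simp only [inner_self_eq_norm_sq]
  have h1 := congrArg (· ^ 2) (Lp.norm_fourier_eq (hf2.toLp f))
  simp only [key] at h1
  refine (integral_congr_ae (hae.symm.mono fun x hx => by simp only [hx])).trans (h1.trans ?_)
  exact integral_congr_ae (hf2.coeFn_toLp.mono fun x hx => by simp only [hx])

/-! ### The fractional gradient on the Fourier side -/

open FourierTransform

/-- The component of the fractional gradient in the direction `v`, as a complex function. -/
noncomputable def fracGradComp {n : ℕ} (s : ℝ) (ψ : Eu n → ℝ) (v x : Eu n) : ℂ :=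
  ((inner ℝ (fracGrad s ψ x) v : ℝ) : ℂ)

lemma fourier_comp_sub {n : ℕ} (f : Eu n → ℂ) (h ξ : Eu n) :
    ∫ x : Eu n, (Real.fourierChar (-inner ℝ x ξ) : ℂ) * f (x - h) =
      (Real.fourierChar (-inner ℝ h ξ) : ℂ) * 𝓕 f ξ := by
  rw [← integral_add_right_eq_self _ h, Real.fourier_eq, ← integral_const_mul]
  congr 1
  ext1 x
  rw [add_sub_cancel_right, inner_add_left, neg_add, AddChar.map_add_eq_mul, Circle.coe_mul,
    Circle.smul_def, smul_eq_mul]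
  ring

namespace IsTestFunction

variable {n : ℕ} {O : Set (Eu n)} {ψ : Eu n → ℝ} {s : ℝ}

lemma fracGradComp_eq (hn : 2 ≤ n) (hs0 : 0 < s) (hs1 : s < 1) (hψ : IsTestFunction O ψ)
    (v x : Eu n) : fracGradComp s ψ v x =
      ((((n : ℝ) - 1 + s) / rieszConst n (1 - s) : ℝ) : ℂ) *
        ∫ h : Eu n, ((ψ x : ℂ) - ψ (x - h)) * (inner ℝ (gradKer s h) v : ℝ) := by
  rw [fracGradComp, fracGrad_eq, real_inner_smul_left, Complex.ofReal_mul, real_inner_comm,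
    ← integral_inner (hψ.integrable_integrand hn hs0 hs1 x), ← integral_complex_ofReal]
  congr 2
  ext1 h
  rw [real_inner_smul_right, real_inner_comm]
  push_cast
  rfl

lemma integrable_fracGradComp (hn : 2 ≤ n) (hs0 : 0 < s) (hs1 : s < 1)
    (hψ : IsTestFunction O ψ) (v : Eu n) : Integrable (fracGradComp s ψ v) volume :=
  ((hψ.integrable_fracGrad hn hs0 hs1).inner_const v).ofReal

lemma memLp_fracGradComp (hn : 2 ≤ n) (hs0 : 0 < s) (hs1 : s < 1)
    (hψ : IsTestFunction O ψ) (v : Eu n) : MemLp (fracGradComp s ψ v) 2 volume :=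
  ((hψ.memLp_fracGrad hn hs0 hs1).inner_const v).ofReal

/-- Fubini, together with the fact that translation by $h$ becomes multiplication by a character.
The integrability statement keeps the factor $\hat\psi(\xi)$ because it comes from integrating out
$x$; the factor can be divided out only where it is nonzero. -/
lemma fourier_fracGradComp (hn : 2 ≤ n) (hs0 : 0 < s) (hs1 : s < 1) (hψ : IsTestFunction O ψ)
    (v ξ : Eu n) :
    Integrable (fun h : Eu n => 𝓕 (fun x => (ψ x : ℂ)) ξ *
      ((1 - (Real.fourierChar (-inner ℝ h ξ) : ℂ)) * (inner ℝ (gradKer s h) v : ℝ))) volume ∧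
    𝓕 (fracGradComp s ψ v) ξ = ((((n : ℝ) - 1 + s) / rieszConst n (1 - s) : ℝ) : ℂ) *
      ∫ h : Eu n, 𝓕 (fun x => (ψ x : ℂ)) ξ *
        ((1 - (Real.fourierChar (-inner ℝ h ξ) : ℂ)) * (inner ℝ (gradKer s h) v : ℝ)) := by
  set G : Eu n × Eu n → ℂ := fun p => (Real.fourierChar (-inner ℝ p.1 ξ) : ℂ) *
    (((ψ p.1 : ℂ) - ψ (p.1 - p.2)) * (inner ℝ (gradKer s p.2) v : ℝ)) with hG
  have hGi : Integrable G ((volume : Measure (Eu n)).prod volume) := by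
    have h1 : Integrable (fun p : Eu n × Eu n =>
        ((ψ p.1 : ℂ) - ψ (p.1 - p.2)) * (inner ℝ (gradKer s p.2) v : ℝ))
        ((volume : Measure (Eu n)).prod volume) := by
      refine (((hψ.integrable_integrand_prod hn hs0 hs1).inner_const v).ofReal (𝕜 := ℂ)).congr
        (ae_of_all _ fun p => ?_)
      simp only [real_inner_smul_left]
      push_cast
      rfl
    refine h1.bdd_mul (c := 1) (Continuous.aestronglyMeasurable ?_)
      (ae_of_all _ fun p => (Circle.norm_coe _).le)
    have := Real.continuous_fourierChar
    fun_prop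
  have hψi : Integrable (fun x => (ψ x : ℂ)) volume := hψ.integrable.ofReal
  have hker : ∀ h : Eu n, ∫ x : Eu n, G (x, h) = 𝓕 (fun x => (ψ x : ℂ)) ξ *
      ((1 - (Real.fourierChar (-inner ℝ h ξ) : ℂ)) * (inner ℝ (gradKer s h) v : ℝ)) := by
    intro h
    have hb : ∀ f : Eu n → ℂ, Integrable f volume →
        Integrable (fun x => (Real.fourierChar (-inner ℝ x ξ) : ℂ) * f x) volume := by
      intro f hf
      refine hf.bdd_mul (c := 1) (Continuous.aestronglyMeasurable ?_) (ae_of_all _ fun p => (Circle.norm_coe _).le)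
      have := Real.continuous_fourierChar
      fun_prop
    have e1 : ∀ x, G (x, h) = ((Real.fourierChar (-inner ℝ x ξ) : ℂ) * (ψ x : ℂ) -
        (Real.fourierChar (-inner ℝ x ξ) : ℂ) * (ψ (x - h) : ℂ)) *
        (inner ℝ (gradKer s h) v : ℝ) := fun x => by simp only [hG]; ring
    simp only [e1]
    rw [integral_mul_const, integral_sub (hb _ hψi) (hb _ (hψi.comp_sub_right h)),
      fourier_comp_sub (fun x => (ψ x : ℂ)) h ξ]
    have e2 : ∫ x : Eu n, (Real.fourierChar (-inner ℝ x ξ) : ℂ) * (ψ x : ℂ) =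
        𝓕 (fun x => (ψ x : ℂ)) ξ := rfl
    rw [e2]
    ring
  constructor
  · exact hGi.integral_prod_right.congr (ae_of_all _ hker)
  · simp only [← hker]
    rw [← integral_integral_swap (f := fun x h => G (x, h)) hGi, ← integral_const_mul,
      Real.fourier_eq]
    congr 1
    ext1 x
    rw [hψ.fracGradComp_eq hn hs0 hs1, Circle.smul_def, smul_eq_mul, mul_left_comm]
    congr 1
    rw [← integral_const_mul]

/-- In direction $v=\xi$ the multiplier is $\int(1-e^{-2\pi i
h\cdot\xi})$`gradKer`$(h)\cdot\xi\,dh$, whose imaginary part is `sinSymbol`. A lower bound needs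
only that part, so the real part is never computed. -/
lemma norm_fourier_le_fourier_fracGradComp (hn : 2 ≤ n) (hs0 : 0 < s) (hs1 : s < 1)
    (hψ : IsTestFunction O ψ) (ξ : Eu n) :
    ((n : ℝ) - 1 + s) / rieszConst n (1 - s) * |sinSymbol s ξ| * ‖𝓕 (fun x => (ψ x : ℂ)) ξ‖ ≤
      ‖𝓕 (fracGradComp s ψ ξ) ξ‖ := by
  obtain ⟨hi, he⟩ := hψ.fourier_fracGradComp hn hs0 hs1 ξ ξ
  have hc := fracGrad_const_pos hn hs0 hs1
  set z := 𝓕 (fun x => (ψ x : ℂ)) ξ with hz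
  rcases eq_or_ne z 0 with h0 | h0
  · simp [h0]
  have hi' : Integrable (fun h : Eu n => (1 - (Real.fourierChar (-inner ℝ h ξ) : ℂ)) *
      (inner ℝ (gradKer s h) ξ : ℝ)) volume := by
    refine (hi.const_mul z⁻¹).congr (ae_of_all _ fun h => ?_)
    dsimp only
    rw [← mul_assoc, inv_mul_cancel₀ h0, one_mul]
  rw [he, integral_const_mul, norm_mul, norm_mul, Complex.norm_of_nonneg hc.le, mul_assoc,
    mul_comm ‖z‖]
  refine mul_le_mul_of_nonneg_left (mul_le_mul_of_nonneg_right ?_ (norm_nonneg _)) hc.le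
  refine le_of_eq_of_le (congrArg _ ?_) (Complex.abs_im_le_norm _)
  have := integral_im (𝕜 := ℂ) hi'
  rw [RCLike.im_eq_complex_im] at this
  rw [← this, sinSymbol]
  congr 1
  ext1 h
  rw [Complex.im_mul_ofReal, Complex.sub_im, Complex.one_im, Real.fourierChar_apply,
    mul_comm (inner ℝ (gradKer s h) ξ)]
  congr 1
  rw [show ((2 * Real.pi * (-inner ℝ h ξ) : ℝ) : ℂ) * Complex.I =
    (((-(2 * Real.pi * inner ℝ h ξ) : ℝ)) : ℂ) * Complex.I by push_cast; ring,
    Complex.exp_ofReal_mul_I_im, Real.sin_neg]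
  ring

lemma fourier_fracGradComp_self (hn : 2 ≤ n) (hs0 : 0 < s) (hs1 : s < 1)
    (hψ : IsTestFunction O ψ) (ξ : Eu n) : 𝓕 (fracGradComp s ψ ξ) ξ =
      ∑ j, (ξ j : ℂ) * 𝓕 (fracGradComp s ψ (EuclideanSpace.single j 1)) ξ := by
  simp only [Real.fourier_eq]
  have hi : ∀ j, Integrable (fun x => Real.fourierChar (-inner ℝ x ξ) •
      fracGradComp s ψ (EuclideanSpace.single j 1) x) volume := fun j =>
    (Real.fourierIntegral_convergent_iff ξ).2 (hψ.integrable_fracGradComp hn hs0 hs1 _)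
  simp only [← integral_const_mul]
  rw [← integral_finsetSum _ fun j _ => (hi j).const_mul _]
  congr 1
  ext1 x
  simp only [Circle.smul_def, smul_eq_mul, fracGradComp, mul_left_comm (Complex.ofReal _)]
  rw [← Finset.mul_sum]
  congr 1
  simp only [PiLp.inner_apply, PiLp.single_apply]
  simp

/-- In direction $\xi$ the symbol has size $|\xi|^{1+s}$; expanding $\xi$ in coordinates costs one
factor $|\xi|$, which cancels. Cauchy–Schwarz on the $n$ components gives the factor $n$. -/
lemma norm_fourier_sq_le (hn : 2 ≤ n) (hs0 : 0 < s) (hs1 : s < 1) :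
    ∃ κ : ℝ, 0 < κ ∧ ∀ (O : Set (Eu n)) (ψ : Eu n → ℝ), IsTestFunction O ψ → ∀ ξ : Eu n,
      (κ * ‖ξ‖ ^ s) ^ 2 * ‖𝓕 (fun x => (ψ x : ℂ)) ξ‖ ^ 2 ≤
        n * ∑ j, ‖𝓕 (fracGradComp s ψ (EuclideanSpace.single j 1)) ξ‖ ^ 2 := by
  obtain ⟨κ, hκ, hsym⟩ := exists_sinSymbol_eq hn hs0 hs1
  have hc := fracGrad_const_pos hn hs0 hs1
  set c := ((n : ℝ) - 1 + s) / rieszConst n (1 - s)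
  refine ⟨c * κ, by positivity, fun O ψ hψ ξ => ?_⟩
  rcases eq_or_ne ξ 0 with rfl | hξ
  · rw [norm_zero, Real.zero_rpow hs0.ne', mul_zero]
    simp only [ne_eq, OfNat.ofNat_ne_zero, not_false_eq_true, zero_pow, zero_mul]
    positivity
  have h0 : 0 < ‖ξ‖ := norm_pos_iff.2 hξ
  have h1 := hψ.norm_fourier_le_fourier_fracGradComp hn hs0 hs1 ξ
  rw [hsym ξ hξ, abs_of_nonneg (by positivity), hψ.fourier_fracGradComp_self hn hs0 hs1,
    Real.rpow_add h0, Real.rpow_one] at h1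
  have h2 : ‖∑ j, (ξ j : ℂ) * 𝓕 (fracGradComp s ψ (EuclideanSpace.single j 1)) ξ‖ ≤
      ‖ξ‖ * ∑ j, ‖𝓕 (fracGradComp s ψ (EuclideanSpace.single j 1)) ξ‖ := by
    rw [Finset.mul_sum]
    refine norm_sum_le_of_le _ fun j _ => ?_
    rw [norm_mul, Complex.norm_real]
    exact mul_le_mul_of_nonneg_right (PiLp.norm_apply_le ξ j) (norm_nonneg _)
  have h3 : c * κ * ‖ξ‖ ^ s * ‖𝓕 (fun x => (ψ x : ℂ)) ξ‖ ≤
      ∑ j, ‖𝓕 (fracGradComp s ψ (EuclideanSpace.single j 1)) ξ‖ := by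
    refine le_of_mul_le_mul_left (le_trans (le_of_eq ?_) (h1.trans h2)) h0
    ring
  rw [← mul_pow]
  refine (pow_le_pow_left₀ (by positivity) h3 2).trans ?_
  simpa using sq_sum_le_card_mul_sum_sq (s := Finset.univ)
    (f := fun j => ‖𝓕 (fracGradComp s ψ (EuclideanSpace.single j 1)) ξ‖)

end IsTestFunction

/-! ### The fractional Poincaré inequality -/

/-- Cauchy–Schwarz on $O$, obtained by integrating $(|\psi|-a\mathbf 1_O)^2\ge0$ and choosing
$a=I/(V+1)$. The $+1$ avoids a separate case of measure zero. -/
lemma sq_integral_abs_le {n : ℕ} {O : Set (Eu n)} (hO : MeasurableSet O) (hfin : volume O ≠ ⊤)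
    {ψ : Eu n → ℝ} (hψ : IsTestFunction O ψ) :
    (∫ x, |ψ x|) ^ 2 ≤ (volume.real O + 1) * ∫ x, ψ x ^ 2 := by
  set I := ∫ x, |ψ x|
  set J := ∫ x, ψ x ^ 2
  have hV : 0 ≤ volume.real O := measureReal_nonneg
  set V := volume.real O
  have hJ : Integrable (fun x => ψ x ^ 2) volume := hψ.memLp.integrable_sq
  have key : ∀ a : ℝ, 2 * a * I ≤ J + a ^ 2 * V := by
    intro a
    have h1 : Integrable (O.indicator (1 : Eu n → ℝ)) volume :=
      (integrable_indicator_iff hO).2 (integrableOn_const hfin)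
    have h2 : ∫ x, O.indicator (1 : Eu n → ℝ) x = V := integral_indicator_one hO
    rw [← h2, ← integral_const_mul, ← integral_const_mul, ← integral_add hJ (h1.const_mul _)]
    refine integral_mono (hψ.integrable.abs.const_mul _) (hJ.add (h1.const_mul _)) fun x => ?_
    by_cases hx : x ∈ O
    · simp only [Set.indicator_of_mem hx, Pi.one_apply]
      nlinarith [sq_nonneg (|ψ x| - a), sq_abs (ψ x)]
    · have : ψ x = 0 := image_eq_zero_of_notMem_tsupport fun h => hx (hψ.2.2 h)
      simp [hx, this]
  have h := key (I / (V + 1))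
  have hV1 : 0 < V + 1 := by positivity
  have e1 : 2 * (I / (V + 1)) * I = 2 * (I ^ 2 / (V + 1)) := by ring
  have e2 : (I / (V + 1)) ^ 2 * V ≤ I ^ 2 / (V + 1) := by
    rw [div_pow, div_mul_eq_mul_div, div_le_div_iff₀ (by positivity) hV1]
    nlinarith [mul_nonneg (sq_nonneg I) hV1.le]
  have : I ^ 2 / (V + 1) ≤ J := by linarith
  rwa [div_le_iff₀ hV1, mul_comm] at this

lemma exists_ball_small {n : ℕ} (hn : 2 ≤ n) {V : ℝ} (hV : 0 < V) :
    ∃ ε : ℝ, 0 < ε ∧ volume.real (Metric.ball (0 : Eu n) ε) * V ≤ 1 / 2 := by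
  have : Nonempty (Fin n) := ⟨⟨0, by omega⟩⟩
  set B := volume.real (Metric.ball (0 : Eu n) 1) with hB
  have hB0 : 0 ≤ B := measureReal_nonneg
  refine ⟨min 1 (1 / (2 * V * (B + 1))), by positivity, ?_⟩
  set ε := min 1 (1 / (2 * V * (B + 1))) with hε
  have hε0 : 0 < ε := by positivity
  rw [measureReal_def, Measure.addHaar_ball _ _ hε0.le, finrank_euclideanSpace_fin,
    ENNReal.toReal_mul, ENNReal.toReal_ofReal (by positivity), ← measureReal_def, ← hB]
  have h1 : ε ^ n ≤ ε := pow_le_of_le_one hε0.le (min_le_left _ _) (by omega)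
  have h2 : ε * (2 * V * (B + 1)) ≤ 1 :=
    (le_div_iff₀ (by positivity)).1 (min_le_right 1 (1 / (2 * V * (B + 1))))
  calc ε ^ n * B * V ≤ ε * (B + 1) * V := by gcongr; linarith
    _ ≤ 1 / 2 := by linarith

/-- The fractional Poincaré inequality for test functions on a set of finite measure. -/
theorem exists_poincare {n : ℕ} (hn : 2 ≤ n) {s : ℝ} (hs0 : 0 < s) (hs1 : s < 1)
    {O : Set (Eu n)} (hO : MeasurableSet O) (hfin : volume O ≠ ⊤) :
    ∃ C : ℝ, 0 ≤ C ∧ ∀ ψ : Eu n → ℝ, IsTestFunction O ψ →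
      ∫ x, ψ x ^ 2 ≤ C * ∫ x, ‖fracGrad s ψ x‖ ^ 2 := by
  obtain ⟨κ, hκ, hF⟩ := IsTestFunction.norm_fourier_sq_le hn hs0 hs1
  have hV1 : 0 < volume.real O + 1 := by positivity
  obtain ⟨ε, hε, hball⟩ := exists_ball_small hn hV1
  have hκε : 0 < (κ * ε ^ s) ^ 2 := by positivity
  -- The radius $\varepsilon$ makes the low-frequency part at most $\frac12\|\psi\|_2^2$; absorbing
  -- it on the left produces the factor 2.
  refine ⟨2 * (n / (κ * ε ^ s) ^ 2), by positivity, fun ψ hψ => ?_⟩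
  set D := (n : ℝ) / (κ * ε ^ s) ^ 2 with hD
  set I := ∫ x, |ψ x|
  have hψi : Integrable (fun x => (ψ x : ℂ)) volume := hψ.integrable.ofReal
  -- Frequency splitting: inside the ball use $|\hat\psi|\le\|\psi\|_{L^1}$, outside it use the
  -- symbol bound with $|\xi|\ge\varepsilon$.
  have hpt : ∀ ξ : Eu n, ‖𝓕 (fun x => (ψ x : ℂ)) ξ‖ ^ 2 ≤
      (Metric.ball (0 : Eu n) ε).indicator 1 ξ * I ^ 2 +
        D * ∑ j, ‖𝓕 (fracGradComp s ψ (EuclideanSpace.single j 1)) ξ‖ ^ 2 := by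
    intro ξ
    have hsum : 0 ≤ ∑ j, ‖𝓕 (fracGradComp s ψ (EuclideanSpace.single j 1)) ξ‖ ^ 2 := by positivity
    by_cases hξ : ξ ∈ Metric.ball (0 : Eu n) ε
    · rw [Set.indicator_of_mem hξ, Pi.one_apply, one_mul]
      have h1 : ‖𝓕 (fun x => (ψ x : ℂ)) ξ‖ ≤ I :=
        (VectorFourier.norm_fourierIntegral_le_integral_norm _ _ _ _ _).trans_eq (by simp [I])
      have := pow_le_pow_left₀ (norm_nonneg _) h1 2
      have : 0 ≤ D * ∑ j, ‖𝓕 (fracGradComp s ψ (EuclideanSpace.single j 1)) ξ‖ ^ 2 := by positivity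
      linarith
    · rw [Set.indicator_of_notMem hξ, zero_mul, zero_add, hD, div_mul_eq_mul_div,
        le_div_iff₀ hκε, mul_comm]
      refine le_trans ?_ (hF O ψ hψ ξ)
      have : ε ≤ ‖ξ‖ := by simpa using hξ
      gcongr
  obtain ⟨hi1, he1⟩ := plancherel_of_integrable_memLp hψi hψ.memLp.ofReal
  have hcomp := fun j => plancherel_of_integrable_memLp
    (hψ.integrable_fracGradComp hn hs0 hs1 (EuclideanSpace.single j 1))
    (hψ.memLp_fracGradComp hn hs0 hs1 (EuclideanSpace.single j 1))
  have hIb : Integrable ((Metric.ball (0 : Eu n) ε).indicator (1 : Eu n → ℝ)) volume :=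
    (integrable_indicator_iff measurableSet_ball).2 (integrableOn_const measure_ball_lt_top.ne)
  have hIs := integrable_finsetSum Finset.univ fun j _ => (hcomp j).1
  have hint := integral_mono hi1 ((hIb.mul_const (I ^ 2)).add (hIs.const_mul D)) hpt
  have hgrad : ∑ j, ∫ x, ‖fracGradComp s ψ (EuclideanSpace.single j 1) x‖ ^ 2 =
      ∫ x, ‖fracGrad s ψ x‖ ^ 2 := by
    rw [← integral_finsetSum _ fun j _ => (memLp_two_iff_integrable_sq_norm
      (hψ.memLp_fracGradComp hn hs0 hs1 _).1).1 (hψ.memLp_fracGradComp hn hs0 hs1 _)]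
    congr 1
    ext1 x
    rw [EuclideanSpace.norm_sq_eq]
    refine Finset.sum_congr rfl fun j _ => ?_
    rw [fracGradComp, Complex.norm_real, EuclideanSpace.inner_single_right]
    simp
  have hadd := integral_add (hIb.mul_const (I ^ 2)) (hIs.const_mul D)
  simp only [Pi.add_apply] at hint
  rw [hadd, he1, integral_mul_const, integral_indicator_one measurableSet_ball,
    integral_const_mul, integral_finsetSum _ fun j _ => (hcomp j).1,
    Finset.sum_congr rfl fun j _ => (hcomp j).2, hgrad] at hint
  simp only [Complex.norm_real, Real.norm_eq_abs, sq_abs] at hint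
  have hI := mul_le_mul_of_nonneg_left (sq_integral_abs_le hO hfin hψ)
    (measureReal_nonneg (μ := volume) (s := Metric.ball (0 : Eu n) ε))
  have hJ : 0 ≤ ∫ x, ψ x ^ 2 := integral_nonneg fun x => sq_nonneg _
  have := mul_le_mul_of_nonneg_right hball hJ
  linarith

lemma norm_Lp_two_sq {α F : Type*} [MeasurableSpace α] {μ : Measure α} [NormedAddCommGroup F]
    [InnerProductSpace ℝ F] (v : Lp F 2 μ) : ‖v‖ ^ 2 = ∫ x, ‖v x‖ ^ 2 ∂μ := by
  rw [← real_inner_self_eq_norm_sq, L2.inner_def]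
  simp only [real_inner_self_eq_norm_sq]

/-- The fractional Poincaré inequality on `H^s_0`. -/
theorem exists_poincare_HsZero {n : ℕ} (hn : 2 ≤ n) {s : ℝ} (hs0 : 0 < s) (hs1 : s < 1)
    {O : Set (Eu n)} (hO : MeasurableSet O) (hfin : volume O ≠ ⊤) :
    ∃ C : ℝ, 0 ≤ C ∧ ∀ u : HsZero s O, ‖u‖ ^ 2 ≤ (C + 1) * ‖nablaS u‖ ^ 2 := by
  obtain ⟨C, hC, hP⟩ := exists_poincare hn hs0 hs1 hO hfin
  refine ⟨C, hC, fun u => ?_⟩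
  -- The inequality is a closed condition on pairs, so it passes from the graph on test functions to
  -- its closure.
  have hclosed : IsClosed {p : L2Pair n | ‖p.fst‖ ^ 2 ≤ C * ‖p.snd‖ ^ 2} :=
    isClosed_le ((WithLp.prod_continuous_ofLp 2 _ _).fst.norm.pow 2)
      (((WithLp.prod_continuous_ofLp 2 _ _).snd.norm.pow 2).const_mul C)
  have hsub : (Submodule.span ℝ (testGraph s O) : Set (L2Pair n)) ⊆
      {p : L2Pair n | ‖p.fst‖ ^ 2 ≤ C * ‖p.snd‖ ^ 2} := by
    intro p hp
    obtain ⟨ψ, hψ, h1, h2⟩ := span_testGraph_subset hn hs0 hs1 O hp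
    rw [Set.mem_ofPred_eq, norm_Lp_two_sq, norm_Lp_two_sq,
      integral_congr_ae (h1.mono fun x hx => show ‖p.fst x‖ ^ 2 = ψ x ^ 2 by
        rw [hx, Real.norm_eq_abs, sq_abs]),
      integral_congr_ae (h2.mono fun x hx => show ‖p.snd x‖ ^ 2 = ‖fracGrad s ψ x‖ ^ 2 by rw [hx])]
    exact hP ψ hψ
  have h := closure_minimal hsub hclosed u.2
  rw [Set.mem_ofPred_eq] at h
  rw [Submodule.coe_norm, WithLp.prod_norm_sq_eq_of_L2, add_mul, one_mul]
  exact add_le_add_left h _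

/-! ### Matrix fields as bounded coercive operators on $L^2$ -/

section Act

variable {n : ℕ} (M N : Matrix (Fin n) (Fin n) ℝ) (v w : Eu n)

lemma act_add : act M (v + w) = act M v + act M w := by
  simp [act, Matrix.mulVec_add]

lemma act_smul (c : ℝ) : act M (c • v) = c • act M v := by
  simp [act, Matrix.mulVec_smul]

lemma act_sub_left : act (M - N) v = act M v - act N v := by
  simp [act, Matrix.sub_mulVec]

lemma inner_act_left : inner ℝ (act M v) w = inner ℝ v (act Mᵀ w) := by
  simp only [act, EuclideanSpace.inner_eq_star_dotProduct, star_trivial]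
  rw [Matrix.dotProduct_mulVec, Matrix.mulVec_transpose, dotProduct_comm]

end Act

namespace MatrixClass

variable {n : ℕ} {lam Lam : ℝ} {A : Eu n → Matrix (Fin n) (Fin n) ℝ}

/-- Divide $\Lambda^{-1}|A\xi|^2\le A\xi\cdot\xi\le|A\xi||\xi|$ by $|A\xi|$. -/
lemma norm_act_le (hL : 0 < Lam) (hA : A ∈ MatrixClass lam Lam) :
    ∀ᵐ x ∂(volume : Measure (Eu n)), ∀ ξ : Eu n, ‖act (A x) ξ‖ ≤ Lam * ‖ξ‖ := by
  filter_upwards [hA.2.2] with x hx ξ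
  have h1 := (hx ξ).trans (real_inner_le_norm _ _)
  rcases eq_or_lt_of_le (norm_nonneg (act (A x) ξ)) with h0 | h0
  · rw [← h0]; positivity
  · rw [inv_mul_le_iff₀ hL, sq, mul_left_comm] at h1
    exact le_of_mul_le_mul_left h1 h0

lemma memLp_act (hL : 0 < Lam) (hA : A ∈ MatrixClass lam Lam)
    (g : Lp (Eu n) 2 (volume : Measure (Eu n))) :
    MemLp (fun x => act (A x) (g x)) 2 volume := by
  refine (Lp.memLp g).of_le_mul (c := Lam) ?_ ?_
  · refine AEMeasurable.aestronglyMeasurable ?_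
    refine (WithLp.measurable_toLp 2 _).comp_aemeasurable (aemeasurable_pi_lambda _ fun i => ?_)
    simp only [Matrix.mulVec, dotProduct]
    refine Finset.aemeasurable_fun_sum _ fun j _ => (hA.1 i j).mul ?_
    have hg : AEMeasurable g volume := (Lp.aestronglyMeasurable g).aemeasurable
    fun_prop
  · filter_upwards [norm_act_le hL hA] with x hx using hx _

/-- Multiplication by a matrix field of class `M(λ, Λ)` on `L²(ℝⁿ; ℝⁿ)`. -/
noncomputable def actLp (hL : 0 < Lam) (hA : A ∈ MatrixClass lam Lam) :
    Lp (Eu n) 2 (volume : Measure (Eu n)) →L[ℝ] Lp (Eu n) 2 (volume : Measure (Eu n)) :=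
  LinearMap.mkContinuous
    { toFun := fun g => (memLp_act hL hA g).toLp
      map_add' := fun f g => by
        rw [← MemLp.toLp_add]
        refine MemLp.toLp_congr _ _ ?_
        filter_upwards [Lp.coeFn_add f g] with x hx
        rw [hx, Pi.add_apply, Pi.add_apply, act_add]
      map_smul' := fun c g => by
        rw [RingHom.id_apply, ← MemLp.toLp_const_smul]
        refine MemLp.toLp_congr _ _ ?_
        filter_upwards [Lp.coeFn_smul c g] with x hx
        rw [hx, Pi.smul_apply, Pi.smul_apply, act_smul] }
    Lam fun g => by
      refine Lp.norm_le_mul_norm_of_ae_le_mul ?_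
      filter_upwards [(memLp_act hL hA g).coeFn_toLp, norm_act_le hL hA] with x hx hb
      simpa [hx] using hb (g x)

lemma coeFn_actLp (hL : 0 < Lam) (hA : A ∈ MatrixClass lam Lam)
    (g : Lp (Eu n) 2 (volume : Measure (Eu n))) :
    actLp hL hA g =ᵐ[volume] fun x => act (A x) (g x) :=
  (memLp_act hL hA g).coeFn_toLp

lemma inner_actLp (hL : 0 < Lam) (hA : A ∈ MatrixClass lam Lam)
    (g k : Lp (Eu n) 2 (volume : Measure (Eu n))) :
    inner ℝ (actLp hL hA g) k = ∫ x, inner ℝ (act (A x) (g x)) (k x) := by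
  rw [L2.inner_def]
  exact integral_congr_ae ((coeFn_actLp hL hA g).mono fun x hx => by simp only [hx])

lemma le_inner_actLp (hL : 0 < Lam) (hA : A ∈ MatrixClass lam Lam)
    (g : Lp (Eu n) 2 (volume : Measure (Eu n))) :
    lam * ‖g‖ ^ 2 ≤ inner ℝ (actLp hL hA g) g := by
  rw [norm_Lp_two_sq, ← integral_const_mul, L2.inner_def]
  refine integral_mono_ae ?_ (L2.integrable_inner _ _) ?_
  · exact ((memLp_two_iff_integrable_sq_norm (Lp.memLp g).1).1 (Lp.memLp g)).const_mul _
  · filter_upwards [coeFn_actLp hL hA g, hA.2.1] with x hx hc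
    simpa only [hx] using hc (g x)

end MatrixClass

/-! ### Existence of weak solutions -/

instance {n : ℕ} (s : ℝ) (O : Set (Eu n)) : CompleteSpace (HsZero s O) :=
  (Submodule.isClosed_topologicalClosure _).completeSpace_coe

lemma norm_nablaS_le {n : ℕ} {s : ℝ} {O : Set (Eu n)} (u : HsZero s O) : ‖nablaS u‖ ≤ ‖u‖ := by
  have h : ‖nablaS u‖ ^ 2 ≤ ‖u‖ ^ 2 := by
    rw [Submodule.coe_norm, WithLp.prod_norm_sq_eq_of_L2]
    exact le_add_of_nonneg_left (sq_nonneg _)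
  exact le_of_sq_le_sq h (norm_nonneg _)

/-- The bilinear form `(u, v) ↦ ∫ A ∇ˢu · ∇ˢv` on `H^s_0(O)`. -/
noncomputable def energyForm {n : ℕ} {lam Lam : ℝ} {A : Eu n → Matrix (Fin n) (Fin n) ℝ} (s : ℝ)
    (O : Set (Eu n)) (hL : 0 < Lam) (hA : A ∈ MatrixClass lam Lam) :
    HsZero s O →L[ℝ] HsZero s O →L[ℝ] ℝ :=
  LinearMap.mkContinuous₂
    (LinearMap.mk₂ ℝ (fun u v => inner ℝ (MatrixClass.actLp hL hA (nablaS u)) (nablaS v))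
      (fun u u' v => by
        rw [show nablaS (u + u') = nablaS u + nablaS u' from rfl, map_add, inner_add_left])
      (fun c u v => by
        rw [show nablaS (c • u) = c • nablaS u from rfl, map_smul, real_inner_smul_left,
          smul_eq_mul])
      (fun u v v' => by
        rw [show nablaS (v + v') = nablaS v + nablaS v' from rfl, inner_add_right])
      (fun c u v => by
        rw [show nablaS (c • v) = c • nablaS v from rfl, real_inner_smul_right, smul_eq_mul]))
    ‖MatrixClass.actLp hL hA‖ fun u v => by
      rw [LinearMap.mk₂_apply]
      refine (norm_inner_le_norm _ _).trans ?_
      gcongr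
      · exact ((MatrixClass.actLp hL hA).le_opNorm _).trans (by gcongr; exact norm_nablaS_le u)
      · exact norm_nablaS_le v

lemma energyForm_apply {n : ℕ} {lam Lam : ℝ} {A : Eu n → Matrix (Fin n) (Fin n) ℝ} {s : ℝ}
    {O : Set (Eu n)} (hL : 0 < Lam) (hA : A ∈ MatrixClass lam Lam) (u v : HsZero s O) :
    energyForm s O hL hA u v = ∫ x : Eu n, inner ℝ (act (A x) (nablaS u x)) (nablaS v x) :=
  MatrixClass.inner_actLp hL hA _ _

/-- Lax–Milgram: ellipticity bounds the form below by $\lambda\|\nabla^su\|^2$, and the Poincaré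
inequality turns this into coercivity in the full norm. No symmetry of $A$ is needed. -/
theorem exists_isWeakSolution {n : ℕ} (hn : 2 ≤ n) {s : ℝ} (hs0 : 0 < s) (hs1 : s < 1)
    {O : Set (Eu n)} (hO : MeasurableSet O) (hfin : volume O ≠ ⊤) {lam Lam : ℝ} (hl : 0 < lam)
    (hL : 0 < Lam) {A : Eu n → Matrix (Fin n) (Fin n) ℝ} (hA : A ∈ MatrixClass lam Lam)
    (f : HsDual s O) : ∃ u : HsZero s O, IsWeakSolution A f u := by
  obtain ⟨C, hC, hP⟩ := exists_poincare_HsZero hn hs0 hs1 hO hfin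
  have hco : IsCoercive (energyForm s O hL hA) := by
    refine ⟨lam / (C + 1), by positivity, fun u => ?_⟩
    refine le_trans ?_ (MatrixClass.le_inner_actLp hL hA (nablaS u))
    rw [mul_assoc, ← sq, div_mul_eq_mul_div, div_le_iff₀ (by positivity), mul_assoc,
      mul_comm _ (C + 1)]
    exact mul_le_mul_of_nonneg_left (hP u) hl.le
  refine ⟨hco.continuousLinearEquivOfBilin.symm ((InnerProductSpace.toDual ℝ _).symm f),
    fun v => ?_⟩
  rw [← energyForm_apply hL hA, ← hco.continuousLinearEquivOfBilin_apply,
    ContinuousLinearEquiv.apply_symm_apply, InnerProductSpace.toDual_symm_apply]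

/-! ### Uniqueness of the limit flux -/

/-- Two `H`-limits act in the same way on all fractional gradients. -/
theorem HConverges.act_nablaS_eq {n : ℕ} (hn : 2 ≤ n) {s : ℝ} (hs0 : 0 < s) (hs1 : s < 1)
    {O : Set (Eu n)} (hO : MeasurableSet O) (hfin : volume O ≠ ⊤) {lam Lam : ℝ} (hl : 0 < lam)
    (hL : 0 < Lam) {A : ℕ → Eu n → Matrix (Fin n) (Fin n) ℝ}
    (hA : ∀ h, A h ∈ MatrixClass lam Lam) {B B' : Eu n → Matrix (Fin n) (Fin n) ℝ}
    (hB : B ∈ MatrixClass lam Lam) (hB' : B' ∈ MatrixClass lam Lam)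
    (hAB : HConverges s O A B) (hAB' : HConverges s O A B') (u : HsZero s O) :
    ∀ᵐ x ∂(volume : Measure (Eu n)), act (B x) (nablaS u x) = act (B' x) (nablaS u x) := by
  -- With this right-hand side the prescribed $u$ is the weak solution for `B`, so every element of
  -- $H^s_0$ is reached.
  set f : HsDual s O := energyForm s O hL hB u
  have hu : IsWeakSolution B f u := fun v => (energyForm_apply hL hB u v).symm
  choose w hw using fun h => exists_isWeakSolution hn hs0 hs1 hO hfin hl hL (hA h) f
  obtain ⟨u', hu'⟩ := exists_isWeakSolution hn hs0 hs1 hO hfin hl hL hB' f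
  obtain ⟨h1, h2⟩ := hAB f w u hw hu
  obtain ⟨h1', h2'⟩ := hAB' f w u' hw hu'
  have huu : u = u' := ext_inner_left ℝ fun v =>
    tendsto_nhds_unique (h1 (InnerProductSpace.toDual ℝ _ v)) (h1' (InnerProductSpace.toDual ℝ _ v))
  subst huu
  have heq : MatrixClass.actLp hL hB (nablaS u) = MatrixClass.actLp hL hB' (nablaS u) :=
    ext_inner_right ℝ fun Φ => by
      rw [MatrixClass.inner_actLp, MatrixClass.inner_actLp]
      exact tendsto_nhds_unique (h2 Φ) (h2' Φ)
  filter_upwards [MatrixClass.coeFn_actLp hL hB (nablaS u),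
    MatrixClass.coeFn_actLp hL hB' (nablaS u)] with x hx hx'
  rw [← hx, ← hx', heq]

/-! ### Recovering the matrix from fractional gradients -/

/-- A test function as an element of `H^s_0`. -/
lemma IsTestFunction.exists_nablaS_eq {n : ℕ} (hn : 2 ≤ n) {s : ℝ} (hs0 : 0 < s) (hs1 : s < 1)
    {O : Set (Eu n)} {ψ : Eu n → ℝ} (hψ : IsTestFunction O ψ) :
    ∃ u : HsZero s O, nablaS u =ᵐ[volume] fracGrad s ψ :=
  ⟨⟨WithLp.toLp 2 (hψ.memLp.toLp ψ, (hψ.memLp_fracGrad hn hs0 hs1).toLp _),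
    subset_closure (Submodule.subset_span
      ⟨ψ, hψ, hψ.memLp.coeFn_toLp, (hψ.memLp_fracGrad hn hs0 hs1).coeFn_toLp⟩)⟩,
    (hψ.memLp_fracGrad hn hs0 hs1).coeFn_toLp⟩

/-- If `ψ ≥ 0` is a nonzero test function supported in a half space `{y | (y - x) · w > 0}`, then
`∇ˢψ(x) · w ≠ 0`. -/
lemma inner_fracGrad_ne_zero {n : ℕ} (hn : 2 ≤ n) {s : ℝ} (hs0 : 0 < s) (hs1 : s < 1)
    {O : Set (Eu n)} {ψ : Eu n → ℝ} (hψ : IsTestFunction O ψ) (h0 : ∀ y, 0 ≤ ψ y) {x w : Eu n}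
    (hO : ∀ y ∈ O, 0 < inner ℝ (y - x) w) (hne : ∃ y, ψ y ≠ 0) :
    inner ℝ (fracGrad s ψ x) w ≠ 0 := by
  have hsupp : ∀ y, ψ y ≠ 0 → 0 < inner ℝ (y - x) w := fun y hy =>
    hO y (hψ.2.2 (subset_tsupport _ hy))
  -- The point $x$ lies on the boundary of the half space, hence outside the support; the integrand
  -- is then $\psi(x-h)$ times a factor that is positive wherever $\psi(x-h)\ne0$.
  have hx : ψ x = 0 := by
    by_contra h
    simpa using hsupp x h
  have hint := hψ.integrable_integrand hn hs0 hs1 x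
  have heq : ∀ h : Eu n, inner ℝ w ((ψ x - ψ (x - h)) • gradKer s h) =
      ψ (x - h) * ((‖h‖ ^ ((n : ℝ) + s + 1))⁻¹ * inner ℝ (x - h - x) w) := by
    intro h
    rw [real_inner_smul_right, gradKer, real_inner_smul_right, hx, sub_sub_cancel_left,
      inner_neg_left, real_inner_comm]
    ring
  rw [fracGrad_eq, real_inner_smul_left, real_inner_comm, ← integral_inner hint]
  refine mul_ne_zero (fracGrad_const_pos hn hs0 hs1).ne' (ne_of_gt ?_)
  have hnn : ∀ h : Eu n, 0 ≤ inner ℝ w ((ψ x - ψ (x - h)) • gradKer s h) := by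
    intro h
    rw [heq]
    by_cases hy : ψ (x - h) = 0
    · rw [hy, zero_mul]
    · have := hsupp _ hy
      have := h0 (x - h)
      positivity
  rw [integral_pos_iff_support_of_nonneg hnn (hint.const_inner w)]
  have hopen : IsOpen {h : Eu n | ψ (x - h) ≠ 0} :=
    isOpen_ne.preimage (hψ.continuous.comp (continuous_const.sub continuous_id))
  obtain ⟨y, hy⟩ := hne
  refine (hopen.measure_pos volume ⟨x - y, by simpa using hy⟩).trans_le
    (measure_mono fun h hh => ?_)
  rw [Set.mem_ofPred_eq] at hh
  rw [Function.mem_support, heq]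
  have h3 := hsupp _ hh
  have h4 : h ≠ 0 := by
    rintro rfl
    simp at h3
  have : 0 < ‖h‖ := norm_pos_iff.2 h4
  exact mul_ne_zero hh (by positivity)

/-- Two matrix fields that agree a.e. on the fractional gradients of all test functions on an open
set `O` agree a.e. in `O`. -/
theorem ae_eq_of_forall_act_fracGrad {n : ℕ} (hn : 2 ≤ n) {s : ℝ} (hs0 : 0 < s) (hs1 : s < 1)
    {O : Set (Eu n)} (hO : IsOpen O) {B B' : Eu n → Matrix (Fin n) (Fin n) ℝ}
    (h : ∀ ψ : Eu n → ℝ, IsTestFunction O ψ → ∀ᵐ x ∂(volume : Measure (Eu n)),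
      act (B x) (fracGrad s ψ x) = act (B' x) (fracGrad s ψ x)) :
    ∀ᵐ x ∂(volume : Measure (Eu n)), x ∈ O → B x = B' x := by
  -- One bump per basic open set: countability allows a single null set, while the basis still
  -- offers a bump in any nonempty open subset of $O$, which may depend on $x$ and $w$.
  set S := {b ∈ TopologicalSpace.countableBasis (Eu n) | b.Nonempty ∧ b ⊆ O}
  have hS : S.Countable := (TopologicalSpace.countable_countableBasis _).mono fun b hb => hb.1
  have hbump : ∀ b : S, ∃ ψ : Eu n → ℝ, IsTestFunction b.1 ψ ∧ (∀ y, 0 ≤ ψ y) ∧ ∃ y, ψ y ≠ 0 := by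
    rintro ⟨b, hb, ⟨y, hy⟩, -⟩
    obtain ⟨ψ, h1, h2, h3, h4, h5⟩ := exists_contDiff_tsupport_subset (n := ⊤)
      ((TopologicalSpace.isOpen_of_mem_countableBasis hb).mem_nhds hy)
    exact ⟨ψ, ⟨h3, h2, h1⟩, fun z => (h4 ⟨z, rfl⟩).1, y, by rw [h5]; exact one_ne_zero⟩
  choose ψ hψ hψ0 hψne using hbump
  have : Countable S := hS.to_subtype
  have hall : ∀ᵐ x ∂(volume : Measure (Eu n)), ∀ b : S,
      act (B x) (fracGrad s (ψ b) x) = act (B' x) (fracGrad s (ψ b) x) :=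
    ae_all_iff.2 fun b => h _ ⟨(hψ b).1, (hψ b).2.1, (hψ b).2.2.trans b.2.2.2⟩
  filter_upwards [hall] with x hx hxO
  rw [← sub_eq_zero]
  -- If $w=(B-B')^{T}\eta\neq0$ at $x$, a bump on the side $(y-x)\cdot w>0$ gives
  -- $\nabla^s\psi(x)\cdot w\ne0$, whereas $\nabla^s\psi(x)\cdot
  -- w=(B-B')\nabla^s\psi(x)\cdot\eta=0$. The transpose moves the test direction onto the gradient.
  have hw : ∀ η : Eu n, act (B x - B' x)ᵀ η = 0 := by
    intro η
    by_contra hne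
    set w := act (B x - B' x)ᵀ η with hw
    set U : Set (Eu n) := O ∩ {y | 0 < inner ℝ (y - x) w} with hU
    have hcont : Continuous fun y : Eu n => inner ℝ (y - x) w := by fun_prop
    have hUo : IsOpen U := hO.inter (isOpen_lt continuous_const hcont)
    have hUne : U.Nonempty := by
      have ht : Tendsto (fun t : ℝ => x + t • w) (𝓝[>] 0) (𝓝 x) := by
        have : Continuous fun t : ℝ => x + t • w := by fun_prop
        simpa using (this.tendsto 0).mono_left nhdsWithin_le_nhds
      obtain ⟨t, ht1, ht2⟩ := ((ht.eventually (hO.mem_nhds hxO)).and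
        self_mem_nhdsWithin).exists
      refine ⟨x + t • w, ht1, ?_⟩
      have : 0 < ‖w‖ := norm_pos_iff.2 hne
      have ht0 : 0 < t := ht2
      rw [Set.mem_ofPred_eq, add_sub_cancel_left, real_inner_smul_left, real_inner_self_eq_norm_sq]
      positivity
    obtain ⟨y, hy⟩ := hUne
    obtain ⟨b, hb, hyb, hbU⟩ := (TopologicalSpace.isBasis_countableBasis
      (Eu n)).exists_subset_of_mem_open hy hUo
    set b' : S := ⟨b, hb, ⟨y, hyb⟩, hbU.trans Set.inter_subset_left⟩
    refine inner_fracGrad_ne_zero hn hs0 hs1 (hψ b') (hψ0 b') (x := x) (w := w)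
      (fun z hz => (hbU hz).2) (hψne b') ?_
    rw [hw, ← inner_act_left, act_sub_left, hx b', sub_self, inner_zero_left]
  rw [← Matrix.transpose_eq_zero]
  refine Matrix.ext_of_mulVec_single fun i => ?_
  have hcol : (B x - B' x)ᵀ *ᵥ Pi.single i 1 = 0 :=
    congrArg WithLp.ofLp (hw (EuclideanSpace.single i 1))
  rw [hcol, Matrix.zero_mulVec]

end FracH

theorem mainTheorem9 (n : ℕ) (hn : 2 ≤ n) (s : ℝ) (hs0 : 0 < s) (hs1 : s < 1)
    (Ω : Set (FracH.Eu n)) (hΩ : IsOpen Ω) (hΩb : Bornology.IsBounded Ω)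
    (lam Lam : ℝ) (hlam : 0 < lam) (hlL : lam ≤ Lam)
    (A₀ : FracH.Eu n → Matrix (Fin n) (Fin n) ℝ) (hA₀ : A₀ ∈ FracH.MatrixClass lam Lam)
    (A : ℕ → FracH.Eu n → Matrix (Fin n) (Fin n) ℝ)
    (hA : ∀ h, A h ∈ FracH.MatrixClassOn lam Lam Ω A₀)
    (Ainf Ainf' : FracH.Eu n → Matrix (Fin n) (Fin n) ℝ)
    (hAinf : Ainf ∈ FracH.MatrixClassOn lam Lam Ω A₀)
    (hAinf' : Ainf' ∈ FracH.MatrixClassOn lam Lam Ω A₀)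
    (hconv : FracH.HConverges s Ω A Ainf) (hconv' : FracH.HConverges s Ω A Ainf') :
    ∀ᵐ x ∂(MeasureTheory.volume : MeasureTheory.Measure (FracH.Eu n)), Ainf x = Ainf' x := by
  have hin := FracH.ae_eq_of_forall_act_fracGrad hn hs0 hs1 hΩ (B := Ainf) (B' := Ainf')
    fun ψ hψ => by
      obtain ⟨u, hu⟩ := hψ.exists_nablaS_eq hn hs0 hs1
      filter_upwards [hu, hconv.act_nablaS_eq hn hs0 hs1 hΩ.measurableSet hΩb.measure_lt_top.ne
        hlam (hlam.trans_le hlL) (fun h => (hA h).1) hAinf.1 hAinf'.1 hconv' u] with x h1 h2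
      rwa [h1] at h2
  filter_upwards [hin, hAinf.2, hAinf'.2] with x h1 h2 h3
  by_cases hx : x ∈ Ω
  · exact h1 hx
  · rw [h2 hx, h3 hx]
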